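/- Let $(\Omega,\mathcal F,\mathbb P)$ be an atomless probability space, let $N\ge 2$, and write $L^\infty=L^\infty(\Omega,\mathcal F,\mathbb P)$, with (in)equalities understood a.s. Let $\rho\colon L^\infty\to\mathbb R$ be a coherent risk measure: $\rho(\xi)\le 0$ if $\xi\ge 0$; $\rho$ is convex; $\rho(\xi+a)=\rho(\xi)-a$ for $a\in\mathbb R$; $\rho(\lambda\xi)=\lambda\rho(\xi)$ for $\lambda\ge 0$; and $\rho(\xi_n)\uparrow\rho(\xi)$ whenever $\xi_n\downarrow\xi$ in $L^\infty$. Its scenario set $\mathcal S$ is the set of all probability measures $\mathbb Q\ll\mathbb P$ with $\mathbb E_{\mathbb Q}[-\xi]\le\rho(\xi)$ for all $\xi\in L^\infty$, identified through $d\mathbb Q/d\mathbb P$ with a subset of $L^1(\mathbb P)$. Suppose that: 1. $\rho$ is commonotonic: $\rho(\xi+\eta)=\rho(\xi)+\rho(\eta)$ whenever $\xi=f(\zeta)$ and $\eta=g(\zeta)$ for some random variable $\zeta$ and non-decreasing $f,g\colon\mathbb R\to\mathbb R$; 2. $\mathcal S$ is weakly compact in $L^1(\mathbb P)$; 3. $\rho$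 is cohesive: for all $X_1,\dots,X_N\in L^\infty$ with $X_i\ge 0$ there are $Y_1,\dots,Y_N\in L^\infty$ with $Y_i\ge 0$ such that, with $S=\sum_{i} X_i$ and $m=\rho(-S)$, one has $\sum_{i} Y_i=m$ and, for every $k$, $Y_k=\frac{X_k}{S}\,m$ on $\{S>m\}$, $Y_k\ge X_k$ on $\{S\le m\}$, and $\rho(Y_k-X_k)\le 0$; 4. $\rho$ is law-determined: $\rho(\xi)=\rho(\eta)$ whenever $\xi,\eta\in L^\infty$ have the same distribution under $\mathbb P$. Then there is a level $\alpha\in(0,1]$ with $\rho=AV@R_{(\mathbb P,\alpha)}$, that is, for every $\xi\in L^\infty$, $$\rho(\xi)=\max\Big\{\mathbb E_{\mathbb Q}[-\xi] \;:\; \mathbb Q\ll\mathbb P \text{ a probability measure with } \tfrac{d\mathbb Q}{d\mathbb P}\le\tfrac1\alpha\ \ \mathbb P\text{-a.s.}\Big\}.$$ -/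

import Mathlib

open MeasureTheory ProbabilityTheory Filter Topology
open scoped ENNReal

namespace CohesiveRisk

variable {Ω : Type*} [MeasurableSpace Ω]

/-- A measure is atomless if every measurable set of positive measure has a measurable subset
of strictly smaller, positive measure. -/
def IsAtomless (P : Measure Ω) : Prop :=
  ∀ A : Set Ω, MeasurableSet A → 0 < P A →
    ∃ B : Set Ω, B ⊆ A ∧ MeasurableSet B ∧ 0 < P B ∧ P B < P A

/-- Coherent risk measures on `L^∞(P)`. Given the other axioms `ρ` is antitone, so that in the
Fatou property the convergence `ρ (ξ n) → ρ η` along `ξ n ↓ η` is automatically from below. -/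
structure IsCoherent (P : Measure Ω) [IsProbabilityMeasure P] (ρ : Lp ℝ ∞ P → ℝ) : Prop where
  nonpos_of_nonneg : ∀ ξ : Lp ℝ ∞ P, 0 ≤ ξ → ρ ξ ≤ 0
  convex : ∀ (ξ η : Lp ℝ ∞ P) (t : ℝ), 0 ≤ t → t ≤ 1 →
    ρ (t • ξ + (1 - t) • η) ≤ t * ρ ξ + (1 - t) * ρ η
  translation : ∀ (ξ : Lp ℝ ∞ P) (a : ℝ), ρ (ξ + Lp.const ∞ P a) = ρ ξ - a
  pos_homogeneous : ∀ (ξ : Lp ℝ ∞ P) (t : ℝ), 0 ≤ t → ρ (t • ξ) = t * ρ ξ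
  fatou : ∀ (ξ : ℕ → Lp ℝ ∞ P) (η : Lp ℝ ∞ P), Antitone ξ →
    (∀ᵐ ω ∂P, Tendsto (fun n => ξ n ω) atTop (𝓝 (η ω))) →
    Tendsto (fun n => ρ (ξ n)) atTop (𝓝 (ρ η))

/-- The densities `dQ/dP`, as elements of `L¹(P)`, of the probability measures `Q ≪ P`. -/
def densities (P : Measure Ω) : Set (Lp ℝ 1 P) :=
  {f | 0 ≤ f ∧ ∫ ω, f ω ∂P = 1}

/-- `E_Q[-ξ]`, where `f = dQ/dP`. -/
noncomputable def expectedLoss (P : Measure Ω) (f : Lp ℝ 1 P) (ξ : Lp ℝ ∞ P) : ℝ :=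
  ∫ ω, f ω * (-ξ ω) ∂P

/-- The scenario set of `ρ`: all probability measures `Q ≪ P`, identified with their densities,
such that `E_Q[-ξ] ≤ ρ(ξ)` for all bounded `ξ`. For coherent `ρ` this is the unique closed convex
set `S` of densities with `ρ(ξ) = sup_{Q ∈ S} E_Q[-ξ]` for all `ξ`. -/
def scenarioSet (P : Measure Ω) (ρ : Lp ℝ ∞ P → ℝ) : Set (Lp ℝ 1 P) :=
  {f | f ∈ densities P ∧ ∀ ξ : Lp ℝ ∞ P, expectedLoss P f ξ ≤ ρ ξ}

/-- The scenario set is compact for the weak topology `σ(L¹, (L¹)*)`. -/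
def HasWeaklyCompactScenarioSet (P : Measure Ω) (ρ : Lp ℝ ∞ P → ℝ) : Prop :=
  IsCompact (toWeakSpace ℝ (Lp ℝ 1 P) '' scenarioSet P ρ)

/-- Two random variables are commonotonic if both are (a.s.) non-decreasing functions of one
random variable. -/
def Commonotonic (P : Measure Ω) (ξ η : Lp ℝ ∞ P) : Prop :=
  ∃ (ζ : Ω → ℝ) (f g : ℝ → ℝ), Measurable ζ ∧ Monotone f ∧ Monotone g ∧
    (∀ᵐ ω ∂P, ξ ω = f (ζ ω)) ∧ (∀ᵐ ω ∂P, η ω = g (ζ ω))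

/-- `ρ` is additive on commonotonic pairs. -/
def IsCommonotonic (P : Measure Ω) (ρ : Lp ℝ ∞ P → ℝ) : Prop :=
  ∀ ξ η : Lp ℝ ∞ P, Commonotonic P ξ η → ρ (ξ + η) = ρ ξ + ρ η

/-- `ρ(ξ)` depends on the distribution of `ξ` under `P` only. -/
def IsLawDetermined (P : Measure Ω) (ρ : Lp ℝ ∞ P → ℝ) : Prop :=
  ∀ ξ η : Lp ℝ ∞ P, IdentDistrib ξ η P P → ρ ξ = ρ η

/-- The admissible payoffs from the total capital `m` for the liability vector `X`. -/
def admissiblePayoffs (P : Measure Ω) [IsProbabilityMeasure P] {N : ℕ}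
    (X : Fin N → Lp ℝ ∞ P) (m : ℝ) : Set (Fin N → Lp ℝ ∞ P) :=
  {Y | (∀ k, 0 ≤ Y k) ∧ ∑ i, Y i = Lp.const ∞ P m ∧
    ∀ k, ∀ᵐ ω ∂P,
      (m < ∑ i, X i ω → Y k ω = X k ω / (∑ i, X i ω) * m) ∧
      (∑ i, X i ω ≤ m → X k ω ≤ Y k ω)}

/-- `ρ` is cohesive (for groups of `N` units): each nonnegative bounded liability vector `X` has,
with total capital `ρ(-∑ X_i)`, an admissible payoff `Y` such that the net worth `Y_i - X_i` of
every unit is acceptable. -/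
def IsCohesive (P : Measure Ω) [IsProbabilityMeasure P] (N : ℕ) (ρ : Lp ℝ ∞ P → ℝ) : Prop :=
  ∀ X : Fin N → Lp ℝ ∞ P, (∀ i, 0 ≤ X i) →
    ∃ Y ∈ admissiblePayoffs P X (ρ (-∑ i, X i)), ∀ i, ρ (Y i - X i) ≤ 0

/-- The probability measures `Q ≪ P` with `dQ/dP ≤ 1/α` a.s., identified with their densities. -/
def tailScenarios (P : Measure Ω) (α : ℝ) : Set (Lp ℝ 1 P) :=
  {f | f ∈ densities P ∧ ∀ᵐ ω ∂P, f ω ≤ 1 / α}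

/-- `r = AV@R_{(P,α)}(ξ)`, that is, `r` is the maximum of `E_Q[-ξ]` over all probability measures
`Q ≪ P` whose density is a.s. bounded by `1/α`. -/
def IsAVaR (P : Measure Ω) (α : ℝ) (ξ : Lp ℝ ∞ P) (r : ℝ) : Prop :=
  IsGreatest ((fun f => expectedLoss P f ξ) '' tailScenarios P α) r

end CohesiveRisk

/-! Put R(f) = ρ(-f) for bounded losses f. Law-determination and atomlessness give R(1_A) = g(P(A))
for a distortion g, and comonotone additivity makes R a Choquet integral, so g determines ρ. If g(p)
= min(p/α, 1), slicing Z above an α-quantile q gives R(Z) = q + E[(Z - q)⁺]/α, which is the AV@R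
(`IsComonotoneLoss.eq_quantile_add`, `isAVaR_quantile_add`).

The form of g comes from cohesion for the liabilities 1_A, 1_B, 0, ..., 0 with A, B disjoint, U = A
∪ B and m = R(1_U) < 1. On U a claim of 1 is paid m; off U the two units receive payoffs with y_A +
y_B ≤ m. Shortfall and payoff are comonotone, so acceptability reads (1 - m) R(1_A) + R(-y_A 1_{Uᶜ})
≤ 0, and likewise for B. Adding both and using R(-m 1_{Uᶜ}) = m² - m yields R(1_A) + R(1_B) ≤ m
(`IsCohesive.indicator_add_le`). With subadditivity, g is additive while below one, hence linear
there; subadditivity and left-continuity (Fatou) exclude a jump up to one (`exists_eq_min_div_one`).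

The degenerate case g = 1 on (0, 1] makes ρ the essential supremum of the loss, whose scenario set
contains all uniform densities and is not weakly compact (`not_isCompact_of_uniform_mem`). -/

namespace CohesiveRisk

/-! ### From coherent risk measures to functionals of losses. -/

variable {Ω : Type*} [MeasurableSpace Ω] {P : Measure Ω} {ρ : Lp ℝ ∞ P → ℝ}

lemma IsCoherent.map_add_le [IsProbabilityMeasure P] (h : IsCoherent P ρ) (ξ η : Lp ℝ ∞ P) :
    ρ (ξ + η) ≤ ρ ξ + ρ η := by
  have h1 := h.convex ((2 : ℝ) • ξ) ((2 : ℝ) • η) (1 / 2) (by norm_num) (by norm_num)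
  rw [h.pos_homogeneous ξ 2 (by norm_num), h.pos_homogeneous η 2 (by norm_num), smul_smul,
    smul_smul] at h1
  norm_num at h1
  linarith

lemma IsCoherent.antitone [IsProbabilityMeasure P] (h : IsCoherent P ρ) : Antitone ρ := by
  intro ξ η hle
  have h1 := h.map_add_le ξ (η - ξ)
  have h2 := h.nonpos_of_nonneg (η - ξ) (sub_nonneg.2 hle)
  rw [add_sub_cancel] at h1
  linarith

open Classical in
/-- The risk `ρ(-f)` of the loss `f`, for an essentially bounded function `f`. -/
noncomputable def lossRisk (P : Measure Ω) (ρ : Lp ℝ ∞ P → ℝ) (f : Ω → ℝ) : ℝ :=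
  if h : MemLp f ∞ P then ρ (-h.toLp f) else 0

lemma lossRisk_eq {f : Ω → ℝ} (h : MemLp f ∞ P) : lossRisk P ρ f = ρ (-h.toLp f) := by
  simp [lossRisk, h]

lemma lossRisk_neg_coeFn (ξ : Lp ℝ ∞ P) : lossRisk P ρ (fun ω => -ξ ω) = ρ ξ := by
  rw [lossRisk_eq (f := fun ω => -ξ ω) (Lp.memLp ξ).neg]
  have h1 : ((Lp.memLp ξ).neg.toLp fun ω => -ξ ω) = -(Lp.memLp ξ).toLp ξ :=
    MemLp.toLp_neg (Lp.memLp ξ)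
  rw [h1, Lp.toLp_coeFn, neg_neg]

/-- A monotone, cash-additive, sublinear functional on bounded losses that is additive on
comonotone pairs and, on events, law-determined and continuous from below. -/
structure IsComonotoneLoss (P : Measure Ω) (R : (Ω → ℝ) → ℝ) : Prop where
  mono : ∀ {f g : Ω → ℝ}, MemLp f ∞ P → MemLp g ∞ P → f ≤ᵐ[P] g → R f ≤ R g
  add_const : ∀ {f : Ω → ℝ} (a : ℝ), MemLp f ∞ P → R (fun ω => f ω + a) = R f + a
  mul : ∀ {f : Ω → ℝ} {t : ℝ}, MemLp f ∞ P → 0 ≤ t → R (fun ω => t * f ω) = t * R f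
  add_le : ∀ {f g : Ω → ℝ}, MemLp f ∞ P → MemLp g ∞ P → R (fun ω => f ω + g ω) ≤ R f + R g
  comonotone_add : ∀ {ζ : Ω → ℝ} {φ γ : ℝ → ℝ}, Measurable ζ → Monotone φ → Monotone γ →
    MemLp (fun ω => φ (ζ ω)) ∞ P → MemLp (fun ω => γ (ζ ω)) ∞ P →
    R (fun ω => φ (ζ ω) + γ (ζ ω)) = R (fun ω => φ (ζ ω)) + R (fun ω => γ (ζ ω))
  law : ∀ {A B : Set Ω}, MeasurableSet A → MeasurableSet B → P A = P B →
    R (A.indicator fun _ => 1) = R (B.indicator fun _ => 1)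
  tendsto : ∀ {A : ℕ → Set Ω}, Monotone A → (∀ n, MeasurableSet (A n)) →
    Tendsto (fun n => R ((A n).indicator fun _ => 1)) atTop
      (𝓝 (R ((⋃ n, A n).indicator fun _ => 1)))

lemma memLp_indicator_one [IsFiniteMeasure P] {A : Set Ω} (hA : MeasurableSet A) :
    MemLp (A.indicator fun _ => (1 : ℝ)) ∞ P :=
  memLp_indicator_const _ hA _ (Or.inr (measure_ne_top _ _))

lemma identDistrib_indicator_one [IsProbabilityMeasure P] {A B : Set Ω} (hA : MeasurableSet A)
    (hB : MeasurableSet B) (h : P A = P B) :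
    IdentDistrib (A.indicator fun _ => (1 : ℝ)) (B.indicator fun _ => (1 : ℝ)) P P := by
  have m1 : Measurable (A.indicator fun _ => (1 : ℝ)) := measurable_const.indicator hA
  have m2 : Measurable (B.indicator fun _ => (1 : ℝ)) := measurable_const.indicator hB
  refine ⟨m1.aemeasurable, m2.aemeasurable, ?_⟩
  have hc : P Aᶜ = P Bᶜ := by rw [prob_compl_eq_one_sub hA, prob_compl_eq_one_sub hB, h]
  ext s hs
  rw [Measure.map_apply m1 hs, Measure.map_apply m2 hs]
  classical
  rw [Set.indicator_const_preimage_eq_union, Set.indicator_const_preimage_eq_union]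
  split_ifs <;> simp [h, hc]

lemma isComonotoneLoss_lossRisk [IsProbabilityMeasure P] (h : IsCoherent P ρ)
    (hco : IsCommonotonic P ρ) (hlaw : IsLawDetermined P ρ) :
    IsComonotoneLoss P (lossRisk P ρ) where
  mono {f g} hf hg hle := by
    rw [lossRisk_eq hf, lossRisk_eq hg]
    apply h.antitone
    rw [neg_le_neg_iff, ← Lp.coeFn_le]
    filter_upwards [hf.coeFn_toLp, hg.coeFn_toLp, hle] with ω h1 h2 h3
    rw [h1, h2]; exact h3
  add_const {f} a hf := by
    have hc : MemLp (fun _ : Ω => a) ∞ P := memLp_const a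
    have hs : MemLp (fun ω => f ω + a) ∞ P := hf.add hc
    rw [lossRisk_eq hf, lossRisk_eq hs]
    have h1 : hs.toLp _ = hf.toLp f + hc.toLp _ :=
      MemLp.toLp_add hf hc
    have h2 : hc.toLp _ = Lp.const ∞ P a := rfl
    have := h.translation (-hf.toLp f) (-a)
    rw [h1, h2, neg_add, ← map_neg, this, sub_neg_eq_add]
  mul {f t} hf ht := by
    have hs : MemLp (fun ω => t * f ω) ∞ P := hf.const_smul t
    rw [lossRisk_eq hf, lossRisk_eq hs]
    have h1 : hs.toLp _ = t • hf.toLp f :=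
      MemLp.toLp_const_smul t hf
    rw [h1, ← smul_neg, h.pos_homogeneous _ _ ht]
  add_le {f g} hf hg := by
    have hs : MemLp (fun ω => f ω + g ω) ∞ P := hf.add hg
    rw [lossRisk_eq hf, lossRisk_eq hg, lossRisk_eq hs]
    have h1 : hs.toLp _ = hf.toLp f + hg.toLp g :=
      MemLp.toLp_add hf hg
    rw [h1, neg_add]
    exact h.map_add_le _ _
  comonotone_add {ζ φ γ} hζ hφ hγ h1 h2 := by
    have hs : MemLp (fun ω => φ (ζ ω) + γ (ζ ω)) ∞ P := h1.add h2
    rw [lossRisk_eq h1, lossRisk_eq h2,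
      lossRisk_eq hs]
    have h3 : hs.toLp _
        = h1.toLp _ + h2.toLp _ := MemLp.toLp_add h1 h2
    rw [h3, neg_add]
    apply hco
    -- Positions are negated losses; reflecting both the argument and the value keeps the functions
    -- non-decreasing.
    refine ⟨fun ω => -ζ ω, fun x => -φ (-x), fun x => -γ (-x), hζ.neg,
      fun x y hxy => neg_le_neg (hφ (neg_le_neg hxy)),
      fun x y hxy => neg_le_neg (hγ (neg_le_neg hxy)), ?_, ?_⟩
    · filter_upwards [Lp.coeFn_neg (h1.toLp _), h1.coeFn_toLp] with ω e1 e2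
      rw [e1, Pi.neg_apply, e2, neg_neg]
    · filter_upwards [Lp.coeFn_neg (h2.toLp _), h2.coeFn_toLp] with ω e1 e2
      rw [e1, Pi.neg_apply, e2, neg_neg]
  law {A B} hA hB hAB := by
    have mA := memLp_indicator_one (P := P) hA
    have mB := memLp_indicator_one (P := P) hB
    rw [lossRisk_eq mA, lossRisk_eq mB]
    apply hlaw
    have e {C : Set Ω} (mC : MemLp (C.indicator fun _ => (1 : ℝ)) ∞ P) :
        ⇑(-mC.toLp _) =ᵐ[P] fun ω => -(C.indicator (fun _ => (1 : ℝ)) ω) := by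
      filter_upwards [Lp.coeFn_neg (mC.toLp _), mC.coeFn_toLp] with ω e1 e2
      rw [e1, Pi.neg_apply, e2]
    have hi := (identDistrib_indicator_one hA hB hAB).comp measurable_neg
    refine ⟨(Lp.aestronglyMeasurable _).aemeasurable, (Lp.aestronglyMeasurable _).aemeasurable, ?_⟩
    rw [Measure.map_congr (e mA), Measure.map_congr (e mB)]
    exact hi.map_eq
  tendsto {A} hA hm := by
    have mA n := memLp_indicator_one (P := P) (hm n)
    have mU := memLp_indicator_one (P := P) (MeasurableSet.iUnion hm)
    simp_rw [lossRisk_eq mU, fun n => lossRisk_eq (ρ := ρ) (mA n)]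
    -- Increasing events are increasing losses, hence decreasing positions.
    apply h.fatou
    · intro m n hmn
      dsimp only
      rw [neg_le_neg_iff, ← Lp.coeFn_le]
      filter_upwards [(mA m).coeFn_toLp, (mA n).coeFn_toLp] with ω h1 h2
      rw [h1, h2]
      exact Set.indicator_le_indicator_of_subset (hA hmn) (fun _ => zero_le_one) ω
    · have e {C : Set Ω} (mC : MemLp (C.indicator fun _ => (1 : ℝ)) ∞ P) :
          ⇑(-mC.toLp _) =ᵐ[P] fun ω => -(C.indicator (fun _ => (1 : ℝ)) ω) := by
        filter_upwards [Lp.coeFn_neg (mC.toLp _), mC.coeFn_toLp] with ω e1 e2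
        rw [e1, Pi.neg_apply, e2]
      filter_upwards [ae_all_iff.2 fun n => e (mA n), e mU] with ω h1 h2
      simp_rw [h1, h2]
      exact (tendsto_indicator_const_apply_iff_eventually (L := atTop) (1 : ℝ) ω |>.2 (by
        by_cases hω : ω ∈ ⋃ n, A n
        · obtain ⟨n, hn⟩ := Set.mem_iUnion.1 hω
          filter_upwards [eventually_ge_atTop n] with k hk
          simp only [hω, iff_true]
          exact hA hk hn
        · exact Eventually.of_forall fun k => by
            simp only [hω, iff_false]
            exact fun hk => hω (Set.mem_iUnion.2 ⟨k, hk⟩))).neg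

end CohesiveRisk

/-! ### Atomless measures. -/

namespace CohesiveRisk

variable {Ω : Type*} [MeasurableSpace Ω] {P : Measure Ω}

/-- Of a proper piece and its complement in `A`, one has at most half the mass. -/
lemma IsAtomless.exists_le_half [IsFiniteMeasure P] (hP : IsAtomless P) {A : Set Ω}
    (hA : MeasurableSet A) (h0 : 0 < P.real A) :
    ∃ B ⊆ A, MeasurableSet B ∧ 0 < P.real B ∧ P.real B ≤ P.real A / 2 := by
  obtain ⟨B, hBA, hB, hB0, hlt⟩ := hP A hA (by
    rwa [Measure.real, ENNReal.toReal_pos_iff, and_iff_left (measure_lt_top P A)] at h0)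
  have hB0' : 0 < P.real B := ENNReal.toReal_pos hB0.ne' (measure_ne_top _ _)
  have hlt' : P.real B < P.real A :=
    (ENNReal.toReal_lt_toReal (measure_ne_top _ _) (measure_ne_top _ _)).2 hlt
  have hd : P.real (A \ B) = P.real A - P.real B := measureReal_sdiff hBA hB
  rcases le_total (P.real B) (P.real A / 2) with h | h
  · exact ⟨B, hBA, hB, hB0', h⟩
  · exact ⟨A \ B, Set.sdiff_subset, hA.diff hB, by linarith, by linarith⟩

lemma IsAtomless.exists_antitone [IsFiniteMeasure P] (hP : IsAtomless P) {A : Set Ω}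
    (hA : MeasurableSet A) (h0 : 0 < P.real A) :
    ∃ B : ℕ → Set Ω, Antitone B ∧ (∀ n, B n ⊆ A) ∧ (∀ n, MeasurableSet (B n)) ∧
      (∀ n, 0 < P.real (B n)) ∧ Tendsto (fun n => P.real (B n)) atTop (𝓝 0) := by
  choose! F hF1 hF2 hF3 hF4 using fun (C : Set Ω) (hC : MeasurableSet C ∧ 0 < P.real C) =>
    hP.exists_le_half hC.1 hC.2
  let B : ℕ → Set Ω := fun n => F^[n] A
  have hs n : B (n + 1) = F (B n) := Function.iterate_succ_apply' F n A
  have hB n : MeasurableSet (B n) ∧ 0 < P.real (B n) := by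
    induction n with
    | zero => exact ⟨hA, h0⟩
    | succ n ih => rw [hs]; exact ⟨hF2 _ ih, hF3 _ ih⟩
  have hanti : Antitone B := antitone_nat_of_succ_le fun n => by rw [hs]; exact hF1 _ (hB n)
  have hle n : P.real (B n) ≤ P.real A * (1 / 2) ^ n := by
    induction n with
    | zero => simp [B]
    | succ n ih =>
      have := hF4 _ (hB n)
      rw [hs, pow_succ]
      linarith
  refine ⟨B, hanti, fun n => hanti (Nat.zero_le n), fun n => (hB n).1, fun n => (hB n).2, ?_⟩
  refine squeeze_zero (fun n => measureReal_nonneg) hle ?_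
  simpa using (tendsto_pow_atTop_nhds_zero_of_lt_one (r := (1 / 2 : ℝ)) (by norm_num)
    (by norm_num)).const_mul (P.real A)

/-- **Sierpiński's theorem**: an atomless finite measure takes all intermediate values. -/
theorem IsAtomless.exists_measureReal_eq [IsFiniteMeasure P] (hP : IsAtomless P) {A : Set Ω}
    (hA : MeasurableSet A) {t : ℝ} (ht : 0 ≤ t) (htA : t ≤ P.real A) :
    ∃ B ⊆ A, MeasurableSet B ∧ P.real B = t := by
  -- Greedy exhaustion: `adm B` collects the sets that can be added to `B` without exceeding `t`,
  -- and each step adds one of at least half the largest possible measure.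
  let adm : Set Ω → Set (Set Ω) := fun B =>
    {C | C ⊆ A \ B ∧ MeasurableSet C ∧ P.real B + P.real C ≤ t}
  have key : ∀ B : Set Ω, ∃ C, P.real B ≤ t → C ∈ adm B ∧ ∀ D ∈ adm B, P.real D ≤ 2 * P.real C := by
    intro B
    by_cases hBt : P.real B ≤ t
    swap
    · exact ⟨∅, fun h => absurd h hBt⟩
    have hne : (∅ : Set Ω) ∈ adm B := ⟨Set.empty_subset _, MeasurableSet.empty, by simpa⟩
    have hbdd : BddAbove (P.real '' adm B) := by
      refine ⟨t, ?_⟩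
      rintro _ ⟨C, hC, rfl⟩
      have := hC.2.2
      have := measureReal_nonneg (μ := P) (s := B)
      linarith
    set s := sSup (P.real '' adm B)
    have hle : ∀ D ∈ adm B, P.real D ≤ s := fun D hD => le_csSup hbdd ⟨D, hD, rfl⟩
    have hs0 : 0 ≤ s := by simpa using hle _ hne
    rcases hs0.eq_or_lt with h | h
    · exact ⟨∅, fun _ => ⟨hne, fun D hD => by simpa [← h] using hle D hD⟩⟩
    · obtain ⟨_, ⟨C, hC, rfl⟩, hlt⟩ := exists_lt_of_lt_csSup (⟨_, ⟨_, hne, rfl⟩⟩ :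
        (P.real '' adm B).Nonempty) (half_lt_self h)
      exact ⟨C, fun _ => ⟨hC, fun D hD => by linarith [hle D hD]⟩⟩
  choose F hF using key
  let B : ℕ → Set Ω := fun n => (fun C => C ∪ F C)^[n] ∅
  have hs n : B (n + 1) = B n ∪ F (B n) := Function.iterate_succ_apply' _ n _
  have hadd n (h : P.real (B n) ≤ t) : P.real (B (n + 1)) = P.real (B n) + P.real (F (B n)) := by
    rw [hs]
    refine measureReal_union ?_ (hF _ h).1.2.1
    exact Set.disjoint_of_subset_right (hF _ h).1.1 Set.disjoint_sdiff_right
  have hB n : B n ⊆ A ∧ MeasurableSet (B n) ∧ P.real (B n) ≤ t := by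
    induction n with
    | zero => exact ⟨Set.empty_subset _, MeasurableSet.empty, by simpa [B]⟩
    | succ n ih =>
      obtain ⟨h1, h2, h3⟩ := (hF _ ih.2.2).1
      refine ⟨?_, ?_, ?_⟩
      · rw [hs]; exact Set.union_subset ih.1 (h1.trans Set.sdiff_subset)
      · rw [hs]; exact ih.2.1.union h2
      · rw [hadd n ih.2.2]; exact h3
  have hmono : Monotone B := monotone_nat_of_le_succ fun n => by rw [hs]; exact Set.subset_union_left
  have hlim : Tendsto (fun n => P.real (B n)) atTop (𝓝 (P.real (⋃ n, B n))) :=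
    (ENNReal.tendsto_toReal (measure_ne_top _ _)).comp (tendsto_measure_iUnion_atTop hmono)
  have hUA : (⋃ n, B n) ⊆ A := Set.iUnion_subset fun n => (hB n).1
  have hUm : MeasurableSet (⋃ n, B n) := MeasurableSet.iUnion fun n => (hB n).2.1
  refine ⟨⋃ n, B n, hUA, hUm, ?_⟩
  have hUt : P.real (⋃ n, B n) ≤ t := le_of_tendsto' hlim fun n => (hB n).2.2
  refine hUt.antisymm (not_lt.1 fun hlt => ?_)
  have hd : P.real (A \ ⋃ n, B n) = P.real A - P.real (⋃ n, B n) := measureReal_sdiff hUA hUm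
  -- If mass were missing, a fixed `D k` of positive measure outside the union would be admissible
  -- at every stage, keeping the increments above half its measure; but they tend to zero.
  obtain ⟨D, -, hDs, hDm, hD0, hDl⟩ := hP.exists_antitone (hA.diff hUm) (by linarith)
  obtain ⟨k, hk⟩ := (hDl.eventually_lt_const (sub_pos.2 hlt)).exists
  have hsmall : Tendsto (fun n => 2 * (P.real (B (n + 1)) - P.real (B n))) atTop (𝓝 0) := by
    simpa using ((hlim.comp (tendsto_add_atTop_nat 1)).sub hlim).const_mul 2
  obtain ⟨n, hn⟩ := (hsmall.eventually_lt_const (hD0 k)).exists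
  have hBU : P.real (B n) ≤ P.real (⋃ n, B n) := measureReal_mono (Set.subset_iUnion B n)
  have := (hF _ (hB n).2.2).2 (D k) ⟨(hDs k).trans (Set.sdiff_subset_sdiff_right
    (Set.subset_iUnion B n)), hDm k, by linarith⟩
  rw [hadd n (hB n).2.2] at hn
  linarith

end CohesiveRisk

/-! ### Distortions that are additive below one. -/

namespace CohesiveRisk

/-- Doubling p ≤ r/2 halves any bound on |h|, and p > r/2 reduces to this case because h(r - p) =
-h(p). Iterating brings the bound to zero. -/
lemma eq_zero_of_additive_of_bounded {h : ℝ → ℝ} {r K : ℝ}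
    (hadd : ∀ p q, 0 ≤ p → 0 ≤ q → p + q ≤ r → h (p + q) = h p + h q) (hr : h r = 0)
    (hK : ∀ p, 0 ≤ p → p ≤ r → |h p| ≤ K) {p : ℝ} (hp : 0 ≤ p) (hpr : p ≤ r) : h p = 0 := by
  have key : ∀ n : ℕ, ∀ p, 0 ≤ p → p ≤ r → |h p| ≤ K * (1 / 2) ^ n := by
    intro n
    induction n with
    | zero => simpa using hK
    | succ n ih =>
      have half : ∀ p, 0 ≤ p → p + p ≤ r → |h p| ≤ K * (1 / 2) ^ (n + 1) := by
        intro p hp hpr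
        have h1 := ih (p + p) (by linarith) hpr
        rw [hadd p p hp hp hpr, ← two_mul, abs_mul, abs_two] at h1
        rw [pow_succ]
        linarith
      intro p hp hpr
      rcases le_total (p + p) r with h1 | h1
      · exact half p hp h1
      · have h2 := half (r - p) (by linarith) (by linarith)
        have h3 := hadd p (r - p) hp (by linarith) (by linarith)
        rw [add_sub_cancel, hr] at h3
        rwa [show h (r - p) = -h p by linarith, abs_neg] at h2
  have hlim : Tendsto (fun n : ℕ => K * (1 / 2 : ℝ) ^ n) atTop (𝓝 0) := by
    simpa using (tendsto_pow_atTop_nhds_zero_of_lt_one (r := (1 / 2 : ℝ)) (by norm_num)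
      (by norm_num)).const_mul K
  exact abs_nonpos_iff.1 (ge_of_tendsto' hlim fun n => key n p hp hpr)

/-- A monotone subadditive distortion that is left-continuous, not identically one on `(0, 1]`, and
additive as long as its values stay below one has the form `p ↦ min (p / α) 1`. -/
lemma exists_eq_min_div_one {g : ℝ → ℝ} (hmono : MonotoneOn g (Set.Icc 0 1)) (h0 : g 0 = 0)
    (h1 : g 1 = 1)
    (hsub : ∀ p q, 0 ≤ p → 0 ≤ q → p + q ≤ 1 → g (p + q) ≤ g p + g q)
    (hadd : ∀ p q, 0 ≤ p → 0 ≤ q → p + q ≤ 1 → g (p + q) < 1 → g (p + q) = g p + g q)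
    (hleft : ∀ p L, 0 < p → p ≤ 1 → (∀ q, 0 ≤ q → q < p → g q ≤ L) → g p ≤ L)
    (hlt : ∃ p, 0 < p ∧ p ≤ 1 ∧ g p < 1) :
    ∃ α, 0 < α ∧ α ≤ 1 ∧ ∀ p, 0 ≤ p → p ≤ 1 → g p = min (p / α) 1 := by
  set T := {p | 0 < p ∧ p ≤ 1 ∧ g p < 1} with hT
  have hTb : BddAbove T := ⟨1, fun p hp => hp.2.1⟩
  -- This supremum is the level α: `g` is linear below it and equals one above it.
  set a := sSup T with ha
  obtain ⟨p₀, hp₀⟩ : T.Nonempty := hlt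
  have ha0 : 0 < a := hp₀.1.trans_le (le_csSup hTb hp₀)
  have ha1 : a ≤ 1 := csSup_le ⟨p₀, hp₀⟩ fun p hp => hp.2.1
  have hge : ∀ p, a < p → p ≤ 1 → g p = 1 := by
    intro p hp hp1
    refine le_antisymm (h1 ▸ hmono ⟨by linarith, hp1⟩ ⟨zero_le_one, le_rfl⟩ hp1) ?_
    by_contra! h
    exact absurd (le_csSup hTb (show p ∈ T from ⟨by linarith, hp1, h⟩)) (not_le.2 hp)
  have hlin : ∀ r ∈ T, ∀ p, 0 ≤ p → p ≤ r → g p = g r / r * p := by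
    intro r hr p hp hpr
    have hr0 := hr.1
    have hgr : 0 ≤ g r := h0 ▸ hmono ⟨le_rfl, zero_le_one⟩ ⟨hr0.le, hr.2.1⟩ hr0.le
    -- Subtracting the chord from 0 to `r` leaves an additive function vanishing at `r`; both terms
    -- lie in [0, g r].
    have := eq_zero_of_additive_of_bounded (h := fun p => g p - g r / r * p) (r := r) (K := g r)
      (by
        intro p q hp hq hpq
        have hlt : g (p + q) < 1 :=
          (hmono ⟨by linarith, by linarith [hr.2.1]⟩ ⟨hr0.le, hr.2.1⟩ hpq).trans_lt hr.2.2
        simp only [hadd p q hp hq (hpq.trans hr.2.1) hlt]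
        ring)
      (by field_simp; ring)
      (by
        intro p hp hpr
        have e1 : g p ≤ g r := hmono ⟨hp, hpr.trans hr.2.1⟩ ⟨hr0.le, hr.2.1⟩ hpr
        have e2 : 0 ≤ g p := h0 ▸ hmono ⟨le_rfl, zero_le_one⟩ ⟨hp, hpr.trans hr.2.1⟩ hp
        have e3 : g r / r * p ≤ g r := by
          rw [div_mul_eq_mul_div, div_le_iff₀ hr0]; gcongr
        have e4 : 0 ≤ g r / r * p := by positivity
        rw [abs_le]; constructor <;> linarith)
      hp hpr
    linarith
  set c := g p₀ / p₀
  have hc0 : 0 ≤ c := div_nonneg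
    (h0 ▸ hmono ⟨le_rfl, zero_le_one⟩ ⟨hp₀.1.le, hp₀.2.1⟩ hp₀.1.le) hp₀.1.le
  have hc : ∀ p, 0 ≤ p → p < a → g p = c * p := by
    intro p hp hpa
    obtain ⟨r, hr, hpr⟩ := exists_lt_of_lt_csSup ⟨p₀, hp₀⟩ hpa
    rcases le_total p₀ r with h | h
    · have e1 := hlin r hr p₀ hp₀.1.le h
      have e2 := hlin r hr p hp hpr.le
      rw [e2]
      have : c = g r / r := by
        rw [div_eq_iff hp₀.1.ne', e1]
      rw [this]
    · exact hlin p₀ hp₀ p hp (hpr.le.trans h)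
  have hga : g a ≤ c * a := hleft a _ ha0 ha1 fun q hq hqa => by
    rw [hc q hq hqa]; gcongr
  have hca : c * a ≤ 1 := by
    have hl : Tendsto (fun x => c * x) (𝓝[<] a) (𝓝 (c * a)) :=
      ((continuous_const_mul c).tendsto a).mono_left nhdsWithin_le_nhds
    refine le_of_tendsto hl ?_
    filter_upwards [Ioo_mem_nhdsLT ha0] with x hx
    rw [← hc x hx.1.le hx.2, ← h1]
    exact hmono ⟨hx.1.le, hx.2.le.trans ha1⟩ ⟨zero_le_one, le_rfl⟩ (hx.2.le.trans ha1)
  -- No jump at `a`: for `a = 1` this is left-continuity; otherwise 1 = g(a + x) ≤ g(a) + g(x) ≤ ca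
  -- + cx, and x ↓ 0.
  have hac : 1 ≤ c * a := by
    rcases ha1.eq_or_lt with h | h
    · rw [← h1]; rw [h] at hga ⊢; exact hga
    · have hl : Tendsto (fun x => c * a + c * x) (𝓝[>] 0) (𝓝 (c * a + c * 0)) :=
        ((continuous_const.add (continuous_const_mul c)).tendsto 0).mono_left nhdsWithin_le_nhds
      rw [mul_zero, add_zero] at hl
      refine ge_of_tendsto hl ?_
      filter_upwards [Ioo_mem_nhdsGT (show 0 < min a (1 - a) from lt_min ha0 (by linarith))]
        with x hx
      have hx1 := hx.2.trans_le (min_le_left _ _)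
      have hx2 := hx.2.trans_le (min_le_right _ _)
      have e1 := hsub a x ha0.le hx.1.le (by linarith)
      rw [hge (a + x) (by linarith [hx.1]) (by linarith), hc x hx.1.le hx1] at e1
      linarith
  have hca1 : c = 1 / a := by
    rw [eq_div_iff ha0.ne']; linarith
  have hga1 : g a = 1 := by
    refine le_antisymm (hga.trans hca) ?_
    have : c * a ≤ g a := by
      have hl : Tendsto (fun x => c * x) (𝓝[<] a) (𝓝 (c * a)) :=
        ((continuous_const_mul c).tendsto a).mono_left nhdsWithin_le_nhds
      refine le_of_tendsto hl ?_
      filter_upwards [Ioo_mem_nhdsLT ha0] with x hx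
      rw [← hc x hx.1.le hx.2]
      exact hmono ⟨hx.1.le, hx.2.le.trans ha1⟩ ⟨ha0.le, ha1⟩ hx.2.le
    linarith
  refine ⟨a, ha0, ha1, fun p hp hp1 => ?_⟩
  rcases lt_trichotomy p a with h | h | h
  · rw [hc p hp h, hca1, min_eq_left ((div_le_one ha0).2 h.le)]; ring
  · rw [h, hga1, div_self ha0.ne', min_self]
  · rw [hge p h hp1, min_eq_right ((one_le_div ha0).2 h.le)]

end CohesiveRisk

/-! ### Choquet integration, quantiles and the average value at risk. -/

namespace CohesiveRisk

variable {Ω : Type*} [MeasurableSpace Ω] {P : Measure Ω} {R : (Ω → ℝ) → ℝ}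

lemma memLp_top_of_abs_le {f : Ω → ℝ} (hf : Measurable f) {C : ℝ} (hC : ∀ ω, |f ω| ≤ C) :
    MemLp f ∞ P :=
  memLp_top_of_bound hf.aestronglyMeasurable C (Eventually.of_forall hC)

namespace IsComonotoneLoss

lemma congr (hR : IsComonotoneLoss P R) {f g : Ω → ℝ} (hf : MemLp f ∞ P) (h : f =ᵐ[P] g) :
    R f = R g :=
  have hg := (memLp_congr_ae h).1 hf
  (hR.mono hf hg h.le).antisymm (hR.mono hg hf h.symm.le)

lemma const [IsFiniteMeasure P] (hR : IsComonotoneLoss P R) (a : ℝ) : R (fun _ => a) = a := by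
  have h0 := hR.mul (memLp_const (1 : ℝ) : MemLp (fun _ : Ω => (1 : ℝ)) ∞ P) le_rfl
  have := hR.add_const a (memLp_const (0 : ℝ) : MemLp (fun _ : Ω => (0 : ℝ)) ∞ P)
  simp only [zero_mul] at h0
  simpa [h0] using this

end IsComonotoneLoss

/-- The sum is a staircase in `w` of step `δ` with `n` stairs: it rounds `w` up by at most `δ`,
provided that `w ≤ n * δ`. -/
lemma min_le_sum_ite_lt {δ : ℝ} (hδ : 0 ≤ δ) {w : ℝ} (hw : 0 ≤ w) (n : ℕ) :
    min w (n * δ) ≤ ∑ k ∈ Finset.range n, (if k * δ < w then δ else 0) ∧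
      ∑ k ∈ Finset.range n, (if k * δ < w then δ else 0) ≤ n * δ ∧
      ∑ k ∈ Finset.range n, (if k * δ < w then δ else 0) ≤ w + δ := by
  induction n with
  | zero => simp [hw, add_nonneg hw hδ]
  | succ n ih =>
    obtain ⟨h1, h2, h3⟩ := ih
    rw [Finset.sum_range_succ]
    push_cast
    split_ifs with h
    · rw [min_eq_right h.le] at h1
      exact ⟨(min_le_right _ _).trans (by linarith), by linarith, by linarith⟩
    · rw [min_eq_left (not_lt.1 h)] at h1
      exact ⟨(min_le_left _ _).trans (by linarith), by linarith, by linarith⟩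

lemma monotone_sum_ite_lt {δ : ℝ} (hδ : 0 ≤ δ) (n : ℕ) :
    Monotone fun w : ℝ => ∑ k ∈ Finset.range n, (if k * δ < w then δ else 0) := by
  intro v w hvw
  refine Finset.sum_le_sum fun k _ => ?_
  split_ifs with h1 h2
  · exact le_rfl
  · exact absurd (h1.trans_le hvw) h2
  · exact hδ
  · exact le_rfl

/-- The stairs are non-decreasing functions of `W`, so their risks add. As `W` is positive with
probability at most `α`, each level set lies on the linear branch of the distortion. -/
lemma IsComonotoneLoss.sum_ite_lt [IsProbabilityMeasure P] (hR : IsComonotoneLoss P R) {α : ℝ}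
    (hα : 0 < α)
    (hψ : ∀ A, MeasurableSet A → R (A.indicator fun _ => 1) = min (P.real A / α) 1)
    {W : Ω → ℝ} (hW : Measurable W) (hWα : P.real {ω | 0 < W ω} ≤ α) {δ : ℝ} (hδ : 0 ≤ δ) (n : ℕ) :
    R (fun ω => ∑ k ∈ Finset.range n, (if k * δ < W ω then δ else 0)) =
      (∫ ω, ∑ k ∈ Finset.range n, (if k * δ < W ω then δ else 0) ∂P) / α := by
  have hmem : ∀ n, MemLp (fun ω => ∑ k ∈ Finset.range n, (if k * δ < W ω then δ else 0)) ∞ P := by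
    intro n
    refine memLp_top_of_abs_le ((monotone_sum_ite_lt hδ n).measurable.comp hW) (C := n * δ) ?_
    intro ω
    have h0 : 0 ≤ ∑ k ∈ Finset.range n, (if k * δ < W ω then δ else 0) :=
      Finset.sum_nonneg fun k _ => by split_ifs <;> simp [hδ]
    rw [abs_of_nonneg h0]
    calc _ ≤ ∑ k ∈ Finset.range n, δ := Finset.sum_le_sum fun k _ => by split_ifs <;> simp [hδ]
      _ = n * δ := by simp
  induction n with
  | zero => simp [hR.const]
  | succ n ih =>
    have hset : MeasurableSet {ω | n * δ < W ω} := measurableSet_lt measurable_const hW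
    have hone : (fun ω => if n * δ < W ω then δ else 0) =
        fun ω => δ * {ω | n * δ < W ω}.indicator (fun _ => 1) ω := by
      ext ω; simp [Set.indicator_apply]
    have hmono : Monotone fun w : ℝ => if n * δ < w then δ else 0 := by
      intro v w hvw
      dsimp only
      split_ifs with h1 h2
      · exact le_rfl
      · exact absurd (h1.trans_le hvw) h2
      · exact hδ
      · exact le_rfl
    have hm1 : MemLp (fun ω => if n * δ < W ω then δ else 0) ∞ P := by
      rw [hone]; exact (memLp_indicator_one hset).const_mul δ
    have hadd := hR.comonotone_add hW (monotone_sum_ite_lt hδ n) hmono (hmem n) hm1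
    have hP : P.real {ω | n * δ < W ω} ≤ α :=
      (measureReal_mono fun ω (hω : n * δ < W ω) =>
        (mul_nonneg n.cast_nonneg hδ).trans_lt hω).trans hWα
    simp_rw [Finset.sum_range_succ]
    rw [hadd, ih, integral_add ((hmem n).integrable le_top) (hm1.integrable le_top), add_div, hone,
      hR.mul (memLp_indicator_one hset) hδ, hψ _ hset, min_eq_left ((div_le_one hα).2 hP),
      integral_const_mul, integral_indicator_const _ hset]
    simp [mul_div_assoc]

lemma IsComonotoneLoss.eq_integral_div [IsProbabilityMeasure P] (hR : IsComonotoneLoss P R) {α : ℝ}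
    (hα : 0 < α)
    (hψ : ∀ A, MeasurableSet A → R (A.indicator fun _ => 1) = min (P.real A / α) 1)
    {W : Ω → ℝ} (hW : Measurable W) (hWα : P.real {ω | 0 < W ω} ≤ α) (hW0 : ∀ ω, 0 ≤ W ω)
    {M : ℝ} (hM : ∀ ω, W ω ≤ M) : R W = (∫ ω, W ω ∂P) / α := by
  have hmW : MemLp W ∞ P := memLp_top_of_abs_le hW fun ω => (abs_of_nonneg (hW0 ω)).trans_le (hM ω)
  have key : ∀ δ, 0 < δ → R W ≤ (∫ ω, W ω ∂P) / α + δ / α ∧ (∫ ω, W ω ∂P) / α ≤ R W + δ := by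
    intro δ hδ
    obtain ⟨n, hn⟩ := exists_nat_ge (M / δ)
    rw [div_le_iff₀ hδ] at hn
    set V : Ω → ℝ := fun ω => ∑ k ∈ Finset.range n, (if k * δ < W ω then δ else 0)
    have hV1 : ∀ ω, W ω ≤ V ω := fun ω => by
      have := (min_le_sum_ite_lt hδ.le (hW0 ω) n).1
      rwa [min_eq_left ((hM ω).trans hn)] at this
    have hV2 : ∀ ω, V ω ≤ W ω + δ := fun ω => (min_le_sum_ite_lt hδ.le (hW0 ω) n).2.2
    have hmV : MemLp V ∞ P :=
      memLp_top_of_abs_le ((monotone_sum_ite_lt hδ.le n).measurable.comp hW) (C := M + δ) fun ω => by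
        rw [abs_of_nonneg ((hW0 ω).trans (hV1 ω))]
        linarith [hV2 ω, hM ω]
    have hRV : R V = (∫ ω, V ω ∂P) / α := hR.sum_ite_lt hα hψ hW hWα hδ.le n
    have iW : Integrable W P := hmW.integrable le_top
    have iV : Integrable V P := hmV.integrable le_top
    have hc : MemLp (fun _ : Ω => δ) ∞ P := memLp_const δ
    constructor
    · have h1 : R W ≤ R V := hR.mono hmW hmV (Eventually.of_forall hV1)
      have h2 : ∫ ω, V ω ∂P ≤ ∫ ω, (W ω + δ) ∂P :=
        integral_mono iV (iW.add (integrable_const δ)) hV2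
      rw [integral_add iW (integrable_const δ)] at h2
      simp only [integral_const, probReal_univ, one_smul] at h2
      rw [← add_div]
      exact (h1.trans hRV.le).trans (by gcongr)
    · have h1 : R V ≤ R (fun ω => W ω + δ) :=
        hR.mono hmV (hmW.add hc) (Eventually.of_forall hV2)
      rw [hR.add_const δ hmW, hRV] at h1
      refine le_trans ?_ h1
      exact div_le_div_of_nonneg_right (integral_mono iW iV hV1) hα.le
  apply le_antisymm
  · refine le_of_forall_pos_le_add fun ε hε => ?_
    simpa [hα.ne'] using (key (ε * α) (by positivity)).1
  · exact le_of_forall_pos_le_add fun ε hε => (key ε hε).2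

/-- Existence of an upper `α`-quantile. -/
lemma exists_quantile [IsProbabilityMeasure P] {Z : Ω → ℝ} (hZ : Measurable Z) {M : ℝ}
    (hM : ∀ ω, |Z ω| ≤ M) {α : ℝ} (hα : 0 < α) (hα1 : α ≤ 1) :
    ∃ q, P.real {ω | q < Z ω} ≤ α ∧ α ≤ P.real {ω | q ≤ Z ω} := by
  -- The quantile is the infimum of `T`; the constraint `-M ≤ x` only keeps `T` bounded below.
  set T := {x | -M ≤ x ∧ P.real {ω | x < Z ω} ≤ α}
  have hT : BddBelow T := ⟨-M, fun x hx => hx.1⟩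
  have hM0 : 0 ≤ M := by
    have : Nonempty Ω := nonempty_of_isProbabilityMeasure P
    exact (abs_nonneg _).trans (hM (Classical.arbitrary Ω))
  have hTM : M ∈ T := by
    refine ⟨by linarith, ?_⟩
    have : {ω | M < Z ω} = ∅ := by
      ext ω; simpa using (le_abs_self _).trans (hM ω)
    simpa [this] using hα.le
  have hq : -M ≤ sInf T := le_csInf ⟨M, hTM⟩ fun x hx => hx.1
  have hinv : Tendsto (fun n : ℕ => 1 / ((n : ℝ) + 1)) atTop (𝓝 0) :=
    tendsto_one_div_add_atTop_nhds_zero_nat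
  refine ⟨sInf T, ?_, ?_⟩
  · have hU : {ω | sInf T < Z ω} = ⋃ n : ℕ, {ω | sInf T + 1 / ((n : ℝ) + 1) < Z ω} := by
      ext ω
      simp only [Set.mem_ofPred_eq, Set.mem_iUnion]
      constructor
      · intro h
        obtain ⟨n, hn⟩ := exists_nat_one_div_lt (sub_pos.2 h)
        exact ⟨n, by linarith⟩
      · rintro ⟨n, hn⟩
        have : 0 < 1 / ((n : ℝ) + 1) := by positivity
        linarith
    have hmono : Monotone fun n : ℕ => {ω | sInf T + 1 / ((n : ℝ) + 1) < Z ω} := by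
      intro m n hmn ω (hω : sInf T + 1 / ((m : ℝ) + 1) < Z ω)
      refine lt_of_le_of_lt ?_ hω
      have := one_div_le_one_div_of_le (by positivity) (show (m : ℝ) + 1 ≤ n + 1 by gcongr)
      linarith
    rw [hU]
    refine le_of_tendsto' ((ENNReal.tendsto_toReal (measure_ne_top _ _)).comp
      (tendsto_measure_iUnion_atTop hmono)) fun n => ?_
    obtain ⟨x, hx, hlt⟩ := exists_lt_of_csInf_lt (s := T) ⟨M, hTM⟩
      (show sInf T < sInf T + 1 / ((n : ℝ) + 1) by linarith [show 0 < 1 / ((n : ℝ) + 1) by positivity])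
    exact (measureReal_mono fun ω (hω : sInf T + 1 / ((n : ℝ) + 1) < Z ω) => (hlt.trans hω)).trans hx.2
  · rcases hq.eq_or_lt with h | h
    · have : {ω | sInf T ≤ Z ω} = Set.univ := by
        ext ω; simpa [← h] using (abs_le.1 (hM ω)).1
      rw [this, probReal_univ]; exact hα1
    · have hI : {ω | sInf T ≤ Z ω} =
          ⋂ n : ℕ, {ω | sInf T - (sInf T + M) * (1 / ((n : ℝ) + 1)) < Z ω} := by
        ext ω
        simp only [Set.mem_ofPred_eq, Set.mem_iInter]
        constructor
        · intro h1 n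
          have : 0 < (sInf T + M) * (1 / ((n : ℝ) + 1)) := mul_pos (by linarith) (by positivity)
          linarith
        · intro h1
          have hl : Tendsto (fun n : ℕ => sInf T - (sInf T + M) * (1 / ((n : ℝ) + 1))) atTop
              (𝓝 (sInf T)) := by
            simpa using (hinv.const_mul (sInf T + M)).const_sub (sInf T)
          exact le_of_tendsto' hl fun n => (h1 n).le
      have hanti : Antitone fun n : ℕ =>
          {ω | sInf T - (sInf T + M) * (1 / ((n : ℝ) + 1)) < Z ω} := by
        intro m n hmn ω (hω : sInf T - (sInf T + M) * (1 / ((n : ℝ) + 1)) < Z ω)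
        refine lt_of_le_of_lt ?_ hω
        have h1 := one_div_le_one_div_of_le (by positivity) (show (m : ℝ) + 1 ≤ n + 1 by gcongr)
        have := mul_le_mul_of_nonneg_left h1 (show 0 ≤ sInf T + M by linarith)
        linarith
      rw [hI]
      refine ge_of_tendsto' ((ENNReal.tendsto_toReal (measure_ne_top _ _)).comp
        (tendsto_measure_iInter_atTop
          (fun n => (measurableSet_lt measurable_const hZ).nullMeasurableSet) hanti
          ⟨0, measure_ne_top _ _⟩)) fun n => ?_
      by_contra! hlt
      have h1 : 0 < 1 / ((n : ℝ) + 1) := by positivity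
      have h2 : 1 / ((n : ℝ) + 1) ≤ 1 := by
        rw [div_le_one (by positivity)]; linarith [show (0 : ℝ) ≤ n from n.cast_nonneg]
      have h3 := csInf_le hT (show sInf T - (sInf T + M) * (1 / ((n : ℝ) + 1)) ∈ T from
        ⟨by nlinarith, hlt.le⟩)
      have : 0 < (sInf T + M) * (1 / ((n : ℝ) + 1)) := mul_pos (by linarith) h1
      linarith

/-- Z = min(Z, q) + (Z - q)⁺ is a comonotone splitting. The excess is positive with probability at
most α, so its risk is its mean over α; the capped part has risk q because {q ≤ Z} has risk one. -/
lemma IsComonotoneLoss.eq_quantile_add [IsProbabilityMeasure P] (hR : IsComonotoneLoss P R) {α : ℝ}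
    (hα : 0 < α)
    (hψ : ∀ A, MeasurableSet A → R (A.indicator fun _ => 1) = min (P.real A / α) 1)
    {Z : Ω → ℝ} (hZ : Measurable Z) {M : ℝ} (hM : ∀ ω, |Z ω| ≤ M) {q : ℝ}
    (hq1 : P.real {ω | q < Z ω} ≤ α) (hq2 : α ≤ P.real {ω | q ≤ Z ω}) :
    R Z = q + (∫ ω, max (Z ω - q) 0 ∂P) / α := by
  have hM1 ω := (abs_le.1 (hM ω)).1
  have hM2 ω := (abs_le.1 (hM ω)).2
  have hmin : MemLp (fun ω => min (Z ω) q) ∞ P :=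
    memLp_top_of_abs_le (hZ.min measurable_const) (C := max M |q|) fun ω =>
      abs_min_le_max_abs_abs.trans (max_le_max (hM ω) le_rfl)
  have hW : Measurable fun ω => max (Z ω - q) 0 := (hZ.sub_const q).max measurable_const
  have hWM : ∀ ω, max (Z ω - q) 0 ≤ M + |q| := fun ω =>
    max_le (by linarith [hM2 ω, neg_abs_le q])
      (by linarith [(abs_nonneg (Z ω)).trans (hM ω), abs_nonneg q])
  have hmax : MemLp (fun ω => max (Z ω - q) 0) ∞ P :=
    memLp_top_of_abs_le hW (C := M + |q|) fun ω => by
      rw [abs_of_nonneg (le_max_right _ _)]; exact hWM ω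
  have hsplit : R Z = R (fun ω => min (Z ω) q) + R (fun ω => max (Z ω - q) 0) := by
    rw [← hR.comonotone_add (φ := fun z => min z q) (γ := fun z => max (z - q) 0) hZ
      (fun x y h => min_le_min_right q h)
      (fun x y h => max_le_max_right 0 (sub_le_sub_right h q)) hmin hmax]
    congr 1
    ext ω
    rcases le_total (Z ω) q with h | h
    · rw [min_eq_left h, max_eq_right (by linarith), add_zero]
    · rw [min_eq_right h, max_eq_left (by linarith)]; ring
  have h1 : R (fun ω => max (Z ω - q) 0) = (∫ ω, max (Z ω - q) 0 ∂P) / α :=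
    hR.eq_integral_div hα hψ hW (by simpa using hq1) (fun ω => le_max_right _ _) hWM
  have h2 : R (fun ω => min (Z ω) q) = q := by
    apply le_antisymm
    · exact (hR.mono hmin (memLp_const q) (Eventually.of_forall fun ω => min_le_right _ _)).trans
        (hR.const q).le
    · have hset : MeasurableSet {ω | q ≤ Z ω} := measurableSet_le measurable_const hZ
      have hI := memLp_indicator_one (P := P) hset
      -- With K = M + |q|, min(Z, q) ≥ K 1_{q ≤ Z} + (q - K), whose risk is exactly q.
      have hK : 0 ≤ M + |q| := (le_max_right _ _).trans
        (hWM (nonempty_of_isProbabilityMeasure P).some)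
      have hm := hI.const_mul (M + |q|)
      have hle := hR.mono (hm.add (memLp_const (q - (M + |q|)))) hmin
        (Eventually.of_forall fun ω => by
          by_cases hω : q ≤ Z ω
          · simp [hω]
          · simp only [Pi.add_apply,
              Set.indicator_of_notMem (show ω ∉ {ω | q ≤ Z ω} from hω), mul_zero, zero_add]
            rw [min_eq_left (le_of_not_ge hω)]
            linarith [hM1 ω, le_abs_self q])
      have e := hR.add_const (q - (M + |q|)) hm
      rw [hR.mul hI hK, hψ _ hset, min_eq_right ((one_le_div hα).2 hq2)] at e
      have e2 : R ((fun ω => (M + |q|) * {ω | q ≤ Z ω}.indicator (fun _ => 1) ω) +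
          fun _ => (q - (M + |q|))) = (M + |q|) * 1 + (q - (M + |q|)) := e
      rw [e2] at hle
      linarith
  rw [hsplit, h1, h2]

/-- The quantile formula for the average value at risk. -/
lemma isAVaR_quantile_add [IsProbabilityMeasure P] {α : ℝ} (hα : 0 < α) {ξ : Lp ℝ ∞ P}
    {Z : Ω → ℝ} (hZ : Measurable Z) {M : ℝ} (hM : ∀ ω, |Z ω| ≤ M)
    (hξ : ∀ᵐ ω ∂P, -ξ ω = Z ω) {q : ℝ}
    (hq1 : P.real {ω | q < Z ω} ≤ α) (hq2 : α ≤ P.real {ω | q ≤ Z ω}) :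
    IsAVaR P α ξ (q + (∫ ω, max (Z ω - q) 0 ∂P) / α) := by
  have hloss (f : Lp ℝ 1 P) : expectedLoss P f ξ = ∫ ω, f ω * Z ω ∂P :=
    integral_congr_ae (by filter_upwards [hξ] with ω h; rw [h])
  have iZ : Integrable Z P := (memLp_top_of_abs_le hZ hM).integrable le_top
  have iW : Integrable (fun ω => max (Z ω - q) 0) P :=
    (iZ.sub (integrable_const q)).sup (integrable_const 0)
  have ifZ {f : Ω → ℝ} (hf : Integrable f P) : Integrable (fun ω => f ω * Z ω) P :=
    hf.mul_bdd (c := M) hZ.aestronglyMeasurable (Eventually.of_forall hM)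
  constructor
  · set G := {ω | q < Z ω}
    set E := {ω | Z ω = q}
    have hG : MeasurableSet G := measurableSet_lt measurable_const hZ
    have hE : MeasurableSet E := measurableSet_eq_fun hZ measurable_const
    have hGE : P.real {ω | q ≤ Z ω} = P.real G + P.real E := by
      have hdisj : Disjoint G E :=
        Set.disjoint_left.2 fun ω (h1 : q < Z ω) (h2 : Z ω = q) => h1.ne' h2
      rw [← measureReal_union hdisj hE]
      congr 1
      ext ω
      simp [G, E, le_iff_lt_or_eq, eq_comm]
    -- The maximizer is (1_G + κ 1_E)/α, with κ the fraction of {Z = q} needed for total mass one.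
    -- If P(E) = 0, then P(G) = α and the default value κ = 0 is right.
    set κ := (α - P.real G) / P.real E
    have hκ : κ * P.real E = α - P.real G := by
      rcases eq_or_ne (P.real E) 0 with h | h
      · rw [h] at hGE ⊢; linarith
      · exact div_mul_cancel₀ _ h
    have hκ0 : 0 ≤ κ := div_nonneg (by linarith) measureReal_nonneg
    have hκ1 : κ ≤ 1 := div_le_one_of_le₀ (by linarith) measureReal_nonneg
    set F : Ω → ℝ := fun ω => (G.indicator (fun _ => 1) ω + κ * E.indicator (fun _ => 1) ω) / α
    have iG : Integrable (G.indicator fun _ => (1 : ℝ)) P := (integrable_const _).indicator hG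
    have iE : Integrable (E.indicator fun _ => (1 : ℝ)) P := (integrable_const _).indicator hE
    have iF : Integrable F P := (iG.add (iE.const_mul κ)).div_const α
    have hFint : ∫ ω, F ω ∂P = 1 := by
      simp only [F]
      rw [integral_div, integral_add iG (iE.const_mul κ), integral_const_mul,
        integral_indicator_const _ hG, integral_indicator_const _ hE]
      simp only [smul_eq_mul, mul_one]
      rw [hκ, add_sub_cancel, div_self hα.ne']
    have hF (ω) : 0 ≤ F ω ∧ F ω ≤ 1 / α ∧ F ω * Z ω = F ω * q + max (Z ω - q) 0 / α := by
      have hb : 0 ≤ F ω * α ∧ F ω * α ≤ 1 ∧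
          F ω * α * Z ω = F ω * α * q + max (Z ω - q) 0 := by
        simp only [F, div_mul_cancel₀ _ hα.ne']
        rcases lt_trichotomy (Z ω) q with h | h | h
        · have h1 : ω ∉ G := fun h' : q < Z ω => h.not_gt h'
          have h2 : ω ∉ E := fun h' : Z ω = q => h.ne h'
          simp [h1, h2, h.le]
        · have h1 : ω ∉ G := fun h' : q < Z ω => h'.ne' h
          have h2 : ω ∈ E := h
          simp [h1, h2, h, hκ0, hκ1]
        · have h1 : ω ∈ G := h
          have h2 : ω ∉ E := fun h' : Z ω = q => h.ne' h'
          simp [h1, h2, h.le]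
      refine ⟨nonneg_of_mul_nonneg_left hb.1 hα, (le_div_iff₀ hα).2 hb.2.1, ?_⟩
      rw [← mul_left_inj' hα.ne', add_mul, div_mul_cancel₀ _ hα.ne']
      linarith [hb.2.2]
    have hmF : MemLp F 1 P := memLp_one_iff_integrable.2 iF
    refine ⟨hmF.toLp F, ⟨⟨?_, ?_⟩, ?_⟩, ?_⟩
    · rw [← Lp.coeFn_nonneg]
      filter_upwards [hmF.coeFn_toLp] with ω h
      rw [h]; exact (hF ω).1
    · rw [integral_congr_ae hmF.coeFn_toLp, hFint]
    · filter_upwards [hmF.coeFn_toLp] with ω h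
      rw [h]; exact (hF ω).2.1
    · dsimp only
      rw [hloss]
      have : ∫ ω, (hmF.toLp F) ω * Z ω ∂P = ∫ ω, (F ω * q + max (Z ω - q) 0 / α) ∂P := by
        refine integral_congr_ae ?_
        filter_upwards [hmF.coeFn_toLp] with ω h
        rw [h, (hF ω).2.2]
      rw [this, integral_add (iF.mul_const q) (iW.div_const α), integral_mul_const, hFint,
        integral_div, one_mul]
  -- Pointwise, 0 ≤ f ≤ 1/α gives f Z ≤ f q + (Z - q)⁺/α.
  · rintro _ ⟨f, ⟨⟨hf0, hf1⟩, hfα⟩, rfl⟩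
    have iF : Integrable f P := L1.integrable_coeFn f
    dsimp only
    rw [hloss]
    have : q + (∫ ω, max (Z ω - q) 0 ∂P) / α = ∫ ω, (f ω * q + max (Z ω - q) 0 / α) ∂P := by
      rw [integral_add (iF.mul_const q) (iW.div_const α), integral_mul_const, hf1, integral_div,
        one_mul]
    rw [this]
    refine integral_mono_ae (ifZ iF) ((iF.mul_const q).add (iW.div_const α)) ?_
    filter_upwards [(Lp.coeFn_nonneg f).2 hf0, hfα] with ω h1 h2
    have h1' : 0 ≤ f ω := h1
    have e1 : f ω * (Z ω - q) ≤ f ω * max (Z ω - q) 0 :=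
      mul_le_mul_of_nonneg_left (le_max_left _ _) h1'
    have e2 : f ω * max (Z ω - q) 0 ≤ 1 / α * max (Z ω - q) 0 :=
      mul_le_mul_of_nonneg_right h2 (le_max_right _ _)
    rw [one_div_mul_eq_div] at e2
    linarith

/-- Every essentially bounded class has a bounded measurable representative. -/
lemma exists_bounded_representative {f : Ω → ℝ} (hf : MemLp f ∞ P) :
    ∃ (Z : Ω → ℝ) (M : ℝ), Measurable Z ∧ (∀ ω, |Z ω| ≤ M) ∧ f =ᵐ[P] Z := by
  set C := (eLpNormEssSup f P).toReal
  have hC : ∀ᵐ ω ∂P, |f ω| ≤ C := by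
    have hfin : eLpNormEssSup f P ≠ ∞ := by simpa using hf.eLpNorm_ne_top
    filter_upwards [ae_le_eLpNormEssSup (f := f) (μ := P)] with ω h
    have := ENNReal.toReal_mono hfin h
    simpa using this
  have hm := hf.aestronglyMeasurable
  have hC0 : 0 ≤ C := ENNReal.toReal_nonneg
  refine ⟨fun ω => max (-C) (min (hm.mk f ω) C), C, measurable_const.max
    (hm.stronglyMeasurable_mk.measurable.min measurable_const), fun ω => ?_, ?_⟩
  · exact abs_le.2 ⟨le_max_left _ _, max_le (by linarith) (min_le_right _ _)⟩
  · filter_upwards [hm.ae_eq_mk, hC] with ω h1 h2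
    rw [← h1, min_eq_left (abs_le.1 h2).2, max_eq_right (abs_le.1 h2).1]

end CohesiveRisk

/-! ### Consequences of cohesion and of weak compactness for the risk of events. -/

namespace CohesiveRisk

variable {Ω : Type*} [MeasurableSpace Ω] {P : Measure Ω} {ρ : Lp ℝ ∞ P → ℝ} {R : (Ω → ℝ) → ℝ}

lemma IsComonotoneLoss.indicator_mono [IsFiniteMeasure P] (hR : IsComonotoneLoss P R) {A B : Set Ω}
    (hA : MeasurableSet A) (hB : MeasurableSet B) (h : A ⊆ B) :
    R (A.indicator fun _ => 1) ≤ R (B.indicator fun _ => 1) :=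
  hR.mono (memLp_indicator_one hA) (memLp_indicator_one hB)
    (Eventually.of_forall (Set.indicator_le_indicator_of_subset h fun _ => zero_le_one))

lemma IsComonotoneLoss.indicator_empty [IsFiniteMeasure P] (hR : IsComonotoneLoss P R) :
    R ((∅ : Set Ω).indicator fun _ => 1) = 0 := by
  rw [Set.indicator_empty, hR.const]

lemma IsComonotoneLoss.indicator_nonneg [IsFiniteMeasure P] (hR : IsComonotoneLoss P R) {A : Set Ω}
    (hA : MeasurableSet A) : 0 ≤ R (A.indicator fun _ => 1) :=
  hR.indicator_empty.symm.le.trans (hR.indicator_mono MeasurableSet.empty hA (Set.empty_subset A))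

omit [MeasurableSpace Ω] in
lemma indicator_union_one_eq_add {A B : Set Ω} (h : Disjoint A B) :
    ((A ∪ B).indicator fun _ => (1 : ℝ)) =
      fun ω => A.indicator (fun _ => 1) ω + B.indicator (fun _ => 1) ω :=
  Set.indicator_union_of_disjoint h _

/-- The risk of a unit that receives the share `m` of its claim on `A`, nothing on `U \ A`, and a
payoff `y` off `U`. -/
lemma IsComonotoneLoss.shortfall_sub [IsFiniteMeasure P] (hR : IsComonotoneLoss P R)
    {A U : Set Ω} (hA : MeasurableSet A) (hU : MeasurableSet U) (hAU : A ⊆ U) {m : ℝ} (hm : m ≤ 1)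
    {y : Ω → ℝ} (hy : Measurable y) (hy0 : ∀ ω, 0 ≤ y ω) (hyL : MemLp y ∞ P) :
    R (fun ω => (1 - m) * A.indicator (fun _ => 1) ω + -Uᶜ.indicator y ω) =
      (1 - m) * R (A.indicator fun _ => 1) + R (fun ω => -Uᶜ.indicator y ω) := by
  -- The two terms have disjoint supports and opposite signs, so they are the positive and negative
  -- parts of `ζ`, both non-decreasing in it.
  set ζ : Ω → ℝ := fun ω => (1 - m) * A.indicator (fun _ => 1) ω - Uᶜ.indicator y ω
  have hζ : Measurable ζ :=
    ((measurable_const.indicator hA).const_mul _).sub (hy.indicator hU.compl)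
  have hφ : (fun ω => max (ζ ω) 0) = fun ω => (1 - m) * A.indicator (fun _ => 1) ω := by
    ext ω
    by_cases h1 : ω ∈ U
    · by_cases h2 : ω ∈ A <;> simp [ζ, h1, h2, hm]
    · have h2 : ω ∉ A := fun h => h1 (hAU h)
      simp [ζ, h1, h2, hy0 ω]
  have hγ : (fun ω => min (ζ ω) 0) = fun ω => -Uᶜ.indicator y ω := by
    ext ω
    by_cases h1 : ω ∈ U
    · by_cases h2 : ω ∈ A <;> simp [ζ, h1, h2, hm]
    · have h2 : ω ∉ A := fun h => h1 (hAU h)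
      simp [ζ, h1, h2, hy0 ω]
  have hA1 := memLp_indicator_one (P := P) hA
  have h := hR.comonotone_add (φ := fun x => max x 0) (γ := fun x => min x 0) hζ
    (fun a b h => max_le_max_right 0 h) (fun a b h => min_le_min_right 0 h)
    (by rw [hφ]; exact hA1.const_mul _) (by rw [hγ]; exact (hyL.indicator hU.compl).neg)
  rw [hφ, hγ, hR.mul hA1 (by linarith)] at h
  rw [← h]
  exact congrArg R (funext fun ω => by rw [congrFun hφ ω, congrFun hγ ω])

/-- Cohesion forces superadditivity on disjoint events of total risk below one. -/
lemma IsCohesive.indicator_add_le [IsProbabilityMeasure P] {N : ℕ} (hN : 2 ≤ N)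
    (hc : IsCohesive P N ρ) (hR : IsComonotoneLoss P (lossRisk P ρ)) {A B : Set Ω}
    (hA : MeasurableSet A) (hB : MeasurableSet B) (hAB : Disjoint A B)
    (hlt : lossRisk P ρ ((A ∪ B).indicator fun _ => 1) < 1) :
    lossRisk P ρ (A.indicator fun _ => 1) + lossRisk P ρ (B.indicator fun _ => 1) ≤
      lossRisk P ρ ((A ∪ B).indicator fun _ => 1) := by
  have hU := hA.union hB
  have mA := memLp_indicator_one (P := P) hA
  have mB := memLp_indicator_one (P := P) hB
  have mU := memLp_indicator_one (P := P) hU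
  set m := lossRisk P ρ ((A ∪ B).indicator fun _ => 1) with hm
  have hm0 : 0 ≤ m := hR.indicator_nonneg hU
  let i : Fin N := ⟨0, by omega⟩
  let j : Fin N := ⟨1, by omega⟩
  have hij : i ≠ j := by simp [i, j]
  let X : Fin N → Lp ℝ ∞ P := Pi.single i (mA.toLp _) + Pi.single j (mB.toLp _)
  have hsum : ∑ k, X k = mU.toLp _ := by
    have : mU.toLp _ = mA.toLp _ + mB.toLp _ := by
      rw [← MemLp.toLp_add mA mB]
      exact MemLp.toLp_congr _ _ (by rw [indicator_union_one_eq_add hAB]; rfl)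
    rw [this]
    simp [X, Finset.sum_add_distrib]
  have hXi : X i = mA.toLp _ := by simp [X, hij]
  have hXj : X j = mB.toLp _ := by simp [X, hij.symm]
  have hX0 : ∀ k, 0 ≤ X k := by
    have hn {C : Set Ω} (mC : MemLp (C.indicator fun _ => (1 : ℝ)) ∞ P) : 0 ≤ mC.toLp _ := by
      rw [← Lp.coeFn_nonneg]
      filter_upwards [mC.coeFn_toLp] with ω h
      rw [h]
      exact Set.indicator_nonneg (fun _ _ => zero_le_one) ω
    intro k
    rcases eq_or_ne k i with rfl | h1
    · rw [hXi]; exact hn mA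
    · rcases eq_or_ne k j with rfl | h2
      · rw [hXj]; exact hn mB
      · simp [X, h1, h2]
  obtain ⟨Y, ⟨hY0, hYsum, hY⟩, hYρ⟩ := hc X hX0
  rw [hsum, ← lossRisk_eq (ρ := ρ) mU, ← hm] at hYsum hY
  have hXsum : ∀ᵐ ω ∂P, ∑ k, X k ω = (A ∪ B).indicator (fun _ => 1) ω := by
    have h1 := Lp.coeFn_finsetSum Finset.univ X
    rw [hsum] at h1
    filter_upwards [h1, mU.coeFn_toLp] with ω h2 h3
    rw [← h3, h2, Finset.sum_apply]
  have hshare {k : Fin N} {C : Set Ω} (hC : MeasurableSet C) (hCU : C ⊆ A ∪ B)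
      (mC : MemLp (C.indicator fun _ => (1 : ℝ)) ∞ P) (hXk : X k = mC.toLp _) :
      (1 - m) * lossRisk P ρ (C.indicator fun _ => 1) +
        lossRisk P ρ (fun ω => -(A ∪ B)ᶜ.indicator (Y k) ω) ≤ 0 := by
    have hmY : Measurable (Y k) := (Lp.stronglyMeasurable (Y k)).measurable
    have hYL : MemLp (Y k) ∞ P := Lp.memLp (Y k)
    have hYk0 := (Lp.coeFn_nonneg (Y k)).2 (hY0 k)
    -- `shortfall_sub` requires a payoff that is nonnegative everywhere, not just almost surely.
    have hmax : (fun ω => max (Y k ω) 0) =ᵐ[P] Y k := by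
      filter_upwards [hYk0] with ω h
      exact max_eq_left h
    have hmaxL := (memLp_congr_ae hmax).2 hYL
    have h1 := hR.shortfall_sub hC hU hCU hlt.le (hmY.max measurable_const)
      (fun ω => le_max_right _ _) hmaxL
    have e1 : lossRisk P ρ (fun ω => -(A ∪ B)ᶜ.indicator (fun ω => max (Y k ω) 0) ω) =
        lossRisk P ρ (fun ω => -(A ∪ B)ᶜ.indicator (Y k) ω) := by
      refine hR.congr (hmaxL.indicator hU.compl).neg ?_
      filter_upwards [hmax] with ω h
      by_cases hω : ω ∈ (A ∪ B)ᶜ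
      · rw [Set.indicator_of_mem hω, Set.indicator_of_mem hω, h]
      · rw [Set.indicator_of_notMem hω, Set.indicator_of_notMem hω]
    rw [e1] at h1
    rw [← h1]
    refine le_trans (le_of_eq ?_) (hYρ k)
    rw [← lossRisk_neg_coeFn (ρ := ρ)]
    refine hR.congr ((mC.const_mul _).add (hmaxL.indicator hU.compl).neg) ?_
    have hXk' : X k =ᵐ[P] C.indicator fun _ => (1 : ℝ) := by rw [hXk]; exact mC.coeFn_toLp
    filter_upwards [hXk', hXsum, hY k, Lp.coeFn_sub (Y k) (X k), hmax] with ω a1 a2 a3 a4 a5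
    rw [a4, Pi.sub_apply, a1]
    rw [a2, a1] at a3
    by_cases hω : ω ∈ A ∪ B
    · have h3 := a3.1 (by simpa [Set.indicator_of_mem hω] using hlt)
      simp only [Set.indicator_of_mem hω, div_one] at h3
      rw [h3, Set.indicator_of_notMem (s := (A ∪ B)ᶜ) (fun h => h hω)]
      ring
    · rw [Set.indicator_of_mem (s := (A ∪ B)ᶜ) hω, Set.indicator_of_notMem fun h => hω (hCU h), a5]
      ring
  have h1 := hshare hA Set.subset_union_left mA hXi
  have h2 := hshare hB Set.subset_union_right mB hXj
  have nL (k) : MemLp (fun ω => -(A ∪ B)ᶜ.indicator (Y k) ω) ∞ P :=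
    ((Lp.memLp (Y k)).indicator hU.compl).neg
  have h3 := hR.add_le (nL i) (nL j)
  have hle : ∀ᵐ ω ∂P, Y i ω + Y j ω ≤ m := by
    have s1 := Lp.coeFn_finsetSum Finset.univ Y
    rw [hYsum] at s1
    filter_upwards [s1, Lp.coeFn_const (p := ∞) (μ := P) m,
      ae_all_iff.2 fun k => (Lp.coeFn_nonneg (Y k)).2 (hY0 k)] with ω b1 b2 b3
    rw [b1, Finset.sum_apply] at b2
    have := Finset.sum_le_sum_of_subset_of_nonneg (Finset.subset_univ ({i, j} : Finset (Fin N)))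
      (f := fun k => Y k ω) fun k _ _ => b3 k
    rw [Finset.sum_pair hij, b2] at this
    exact this
  -- Since Y_i + Y_j ≤ m, the summed negative payoffs dominate -m 1_{Uᶜ} = m 1_U - m, of risk m² -
  -- m.
  have h4 := hR.mono ((mU.const_mul m).add (memLp_const (-m))) ((nL i).add (nL j)) (by
    filter_upwards [hle] with ω hω
    by_cases h : ω ∈ A ∪ B
    · simp only [Pi.add_apply, Set.indicator_of_mem h,
        Set.indicator_of_notMem (s := (A ∪ B)ᶜ) (fun h' => h' h)]
      linarith
    · simp only [Pi.add_apply, Set.indicator_of_notMem h, Set.indicator_of_mem (s := (A ∪ B)ᶜ) h]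
      linarith)
  have h5 : lossRisk P ρ ((fun ω => m * (A ∪ B).indicator (fun _ => 1) ω) + fun _ => -m) =
      m * m + -m := by
    have := hR.add_const (-m) (mU.const_mul m)
    rw [hR.mul mU hm0, ← hm] at this
    exact this
  rw [h5] at h4
  have h6 : m * m + -m ≤ lossRisk P ρ (fun ω => -(A ∪ B)ᶜ.indicator (Y i) ω) +
      lossRisk P ρ (fun ω => -(A ∪ B)ᶜ.indicator (Y j) ω) := h4.trans h3
  -- Together: (1 - m)(R(1_A) + R(1_B)) ≤ m - m² = (1 - m) m.
  have h7 : 0 < 1 - m := by linarith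
  refine le_of_mul_le_mul_left ?_ h7
  linarith

/-- If Z > s > R(Z) on a set B of positive measure, then Z ≥ K 1_B + (s - K) for large K, and the
right side has risk s since R(1_B) = 1. -/
lemma IsComonotoneLoss.ae_le_of_indicator_eq_one [IsProbabilityMeasure P]
    (hR : IsComonotoneLoss P R)
    (h1 : ∀ A, MeasurableSet A → 0 < P.real A → R (A.indicator fun _ => 1) = 1)
    {Z : Ω → ℝ} (hZ : Measurable Z) {M : ℝ} (hM : ∀ ω, |Z ω| ≤ M) : ∀ᵐ ω ∂P, Z ω ≤ R Z := by
  have hZL : MemLp Z ∞ P := memLp_top_of_abs_le hZ hM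
  have key : ∀ n : ℕ, ∀ᵐ ω ∂P, Z ω ≤ R Z + 1 / ((n : ℝ) + 1) := by
    intro n
    have hε : 0 < 1 / ((n : ℝ) + 1) := by positivity
    set s := R Z + 1 / ((n : ℝ) + 1)
    by_contra hne
    set B := {ω | s < Z ω}
    have hB : MeasurableSet B := measurableSet_lt measurable_const hZ
    have hB0 : 0 < P.real B := by
      refine ENNReal.toReal_pos (fun h0 => hne ?_) (measure_ne_top _ _)
      rw [ae_iff]
      simpa [not_le] using h0
    have hI := memLp_indicator_one (P := P) hB
    have hM0 : 0 ≤ M := (abs_nonneg _).trans (hM (nonempty_of_isProbabilityMeasure P).some)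
    have hK : 0 ≤ M + |s| := by positivity
    have hm := hI.const_mul (M + |s|)
    have e := hR.add_const (s - (M + |s|)) hm
    rw [hR.mul hI hK, h1 B hB hB0] at e
    have hle := hR.mono (f := fun ω => (M + |s|) * B.indicator (fun _ => 1) ω + (s - (M + |s|)))
      (hm.add (memLp_const (s - (M + |s|)))) hZL (Eventually.of_forall fun ω => by
        have hl := (abs_le.1 (hM ω)).1
        by_cases hω : ω ∈ B
        · have : s < Z ω := hω
          simp only [Set.indicator_of_mem hω]
          linarith
        · simp only [Set.indicator_of_notMem hω]
          linarith [le_abs_self s])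
    rw [e] at hle
    linarith
  filter_upwards [ae_all_iff.2 key] with ω hω
  have hl : Tendsto (fun n : ℕ => R Z + 1 / ((n : ℝ) + 1)) atTop (𝓝 (R Z)) := by
    simpa using (tendsto_one_div_add_atTop_nhds_zero_nat (𝕜 := ℝ)).const_add (R Z)
  exact ge_of_tendsto' hl hω

/-- The integral over a set, as a continuous functional on `L¹`. -/
noncomputable def setIntegralCLM (P : Measure Ω) (A : Set Ω) : Lp ℝ 1 P →L[ℝ] ℝ where
  toFun f := ∫ ω in A, f ω ∂P
  map_add' f g := by
    rw [integral_congr_ae (ae_restrict_of_ae (Lp.coeFn_add f g))]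
    exact integral_add (L1.integrable_coeFn f).restrict (L1.integrable_coeFn g).restrict
  map_smul' c f := by
    rw [integral_congr_ae (ae_restrict_of_ae (Lp.coeFn_smul c f))]
    exact integral_const_mul c _
  cont := continuous_setIntegral A

/-- In an atomless space, a set of densities that contains all uniform densities is not
relatively weakly compact. -/
lemma not_isCompact_of_uniform_mem [IsProbabilityMeasure P] (hP : IsAtomless P)
    {S : Set (Lp ℝ 1 P)} (hS : IsCompact (toWeakSpace ℝ (Lp ℝ 1 P) '' S))
    (hmem : ∀ A, MeasurableSet A → 0 < P.real A →
      ∀ f : Lp ℝ 1 P, (⇑f =ᵐ[P] fun ω => (P.real A)⁻¹ * A.indicator (fun _ => 1) ω) → f ∈ S) :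
    False := by
  obtain ⟨B, hanti, -, hBm, hB0, hBl⟩ := hP.exists_antitone MeasurableSet.univ (by simp)
  have hL n : MemLp (fun ω => (P.real (B n))⁻¹ * (B n).indicator (fun _ => (1 : ℝ)) ω) 1 P :=
    ((memLp_indicator_one (hBm n)).const_mul _).mono_exponent le_top
  let u : ℕ → Lp ℝ 1 P := fun n => (hL n).toLp _
  have hu n : u n ∈ S := hmem (B n) (hBm n) (hB0 n) _ (hL n).coeFn_toLp
  obtain ⟨_, ⟨f, -, rfl⟩, hf⟩ := hS (f := map (fun n => toWeakSpace ℝ (Lp ℝ 1 P) (u n)) atTop)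
    (le_principal_iff.2 (mem_map.2 (Eventually.of_forall fun n => ⟨u n, hu n, rfl⟩)))
  -- Integration over `B k` is weakly continuous and equals one on `u n` for n ≥ k, so also at the
  -- cluster point `f`. This contradicts integrability of `f`, as P(B k) → 0.
  have hone : ∀ k, ∫ ω in B k, f ω ∂P = 1 := by
    intro k
    by_contra hne
    have hcont : Continuous fun x : WeakSpace ℝ (Lp ℝ 1 P) =>
        setIntegralCLM P (B k) ((toWeakSpace ℝ (Lp ℝ 1 P)).symm x) :=
      WeakBilin.eval_continuous (topDualPairing ℝ (Lp ℝ 1 P)).flip (setIntegralCLM P (B k))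
    have hev := (hcont.tendsto (toWeakSpace ℝ (Lp ℝ 1 P) f)).eventually_ne
      (show setIntegralCLM P (B k) ((toWeakSpace ℝ (Lp ℝ 1 P)).symm (toWeakSpace ℝ _ f)) ≠ 1 by
        rw [LinearEquiv.symm_apply_apply]; exact hne)
    have hfr := MapClusterPt.frequently hf hev
    obtain ⟨n, hn, hkn⟩ := (hfr.and_eventually (eventually_ge_atTop k)).exists
    apply hn
    rw [LinearEquiv.symm_apply_apply]
    change ∫ ω in B k, u n ω ∂P = 1
    rw [integral_congr_ae (ae_restrict_of_ae (hL n).coeFn_toLp), integral_const_mul,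
      setIntegral_indicator (hBm n), Set.inter_eq_right.2 (hanti hkn)]
    simp [(hB0 n).ne']
  have hlim : Tendsto (fun k => ∫ ω in B k, f ω ∂P) atTop (𝓝 0) := by
    refine (L1.integrable_coeFn f).tendsto_setIntegral_nhds_zero ?_
    simpa [Function.comp_def] using ENNReal.tendsto_ofReal hBl
  simp_rw [hone] at hlim
  exact one_ne_zero (tendsto_nhds_unique tendsto_const_nhds hlim)

/-- Otherwise ρ bounds every loss almost surely, hence its mean under any density, and the scenario
set contains all uniform densities. -/
lemma exists_indicator_lt_one [IsProbabilityMeasure P] (hP : IsAtomless P)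
    (hR : IsComonotoneLoss P (lossRisk P ρ)) (hc : HasWeaklyCompactScenarioSet P ρ) :
    ∃ A, MeasurableSet A ∧ 0 < P.real A ∧ lossRisk P ρ (A.indicator fun _ => 1) < 1 := by
  by_contra! hcon
  have h1 : ∀ A, MeasurableSet A → 0 < P.real A →
      lossRisk P ρ (A.indicator fun _ => 1) = 1 := fun A hA hA0 => by
    refine le_antisymm ?_ (hcon A hA hA0)
    refine (hR.indicator_mono hA MeasurableSet.univ (Set.subset_univ A)).trans ?_
    rw [Set.indicator_univ, hR.const]
  refine not_isCompact_of_uniform_mem hP hc fun A hA hA0 f hf => ?_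
  have hI : Integrable (A.indicator fun _ => (1 : ℝ)) P := (integrable_const _).indicator hA
  have hint : ∫ ω, f ω ∂P = 1 := by
    rw [integral_congr_ae hf, integral_const_mul, integral_indicator_const _ hA]
    simp [hA0.ne']
  have hf0 : 0 ≤ f := by
    rw [← Lp.coeFn_nonneg]
    filter_upwards [hf] with ω h
    rw [h]
    exact mul_nonneg (inv_nonneg.2 hA0.le) (Set.indicator_nonneg (fun _ _ => zero_le_one) ω)
  refine ⟨⟨hf0, hint⟩, fun ξ => ?_⟩
  obtain ⟨Z, M, hZ, hM, hξ⟩ := exists_bounded_representative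
    (show MemLp (fun ω => -ξ ω) ∞ P from (Lp.memLp ξ).neg)
  have hρ : ρ ξ = lossRisk P ρ Z := by
    rw [← lossRisk_neg_coeFn (ρ := ρ)]
    exact hR.congr (Lp.memLp ξ).neg hξ
  have hle := hR.ae_le_of_indicator_eq_one h1 hZ hM
  have iF : Integrable f P := L1.integrable_coeFn f
  rw [hρ, expectedLoss]
  calc ∫ ω, f ω * -ξ ω ∂P = ∫ ω, f ω * Z ω ∂P :=
        integral_congr_ae (by filter_upwards [hξ] with ω h; rw [h])
    _ ≤ ∫ ω, f ω * lossRisk P ρ Z ∂P := by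
        refine integral_mono_ae (iF.mul_bdd (c := M) hZ.aestronglyMeasurable
          (Eventually.of_forall hM)) (iF.mul_const _) ?_
        filter_upwards [hle, (Lp.coeFn_nonneg f).2 hf0] with ω a b
        exact mul_le_mul_of_nonneg_left a b
    _ = lossRisk P ρ Z := by rw [integral_mul_const, hint, one_mul]

/-- The distortion of the events is that of an average value at risk. -/
lemma exists_indicator_eq_min_div_one [IsProbabilityMeasure P] (hP : IsAtomless P)
    (hR : IsComonotoneLoss P R)
    (hadd : ∀ A B, MeasurableSet A → MeasurableSet B → Disjoint A B →
      R ((A ∪ B).indicator fun _ => 1) < 1 →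
      R (A.indicator fun _ => 1) + R (B.indicator fun _ => 1) ≤ R ((A ∪ B).indicator fun _ => 1))
    (hlt : ∃ A, MeasurableSet A ∧ 0 < P.real A ∧ R (A.indicator fun _ => 1) < 1) :
    ∃ α, 0 < α ∧ α ≤ 1 ∧
      ∀ A, MeasurableSet A → R (A.indicator fun _ => 1) = min (P.real A / α) 1 := by
  have hex : ∀ t : ℝ, ∃ B, 0 ≤ t → t ≤ 1 → MeasurableSet B ∧ P.real B = t := by
    intro t
    by_cases h : 0 ≤ t ∧ t ≤ 1
    · obtain ⟨B, -, hB, ht⟩ := hP.exists_measureReal_eq MeasurableSet.univ h.1 (by simpa using h.2)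
      exact ⟨B, fun _ _ => ⟨hB, ht⟩⟩
    · exact ⟨∅, fun h1 h2 => absurd ⟨h1, h2⟩ h⟩
  -- `F p` is an event of probability `p`; by law-determination the choice does not affect `g`.
  choose F hF using hex
  set g : ℝ → ℝ := fun p => R ((F p).indicator fun _ => 1)
  have hg : ∀ A, MeasurableSet A → R (A.indicator fun _ => 1) = g (P.real A) := fun A hA => by
    obtain ⟨h1, h2⟩ := hF (P.real A) measureReal_nonneg measureReal_le_one
    exact hR.law hA h1 ((measureReal_eq_measureReal_iff).1 h2).symm
  have hpair : ∀ p q, 0 ≤ p → 0 ≤ q → p + q ≤ 1 → ∃ A B, MeasurableSet A ∧ MeasurableSet B ∧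
      Disjoint A B ∧ P.real A = p ∧ P.real B = q ∧ P.real (A ∪ B) = p + q := by
    intro p q hp hq hpq
    obtain ⟨A, -, hA, hAp⟩ := hP.exists_measureReal_eq MeasurableSet.univ hp (by simp; linarith)
    obtain ⟨B, hBA, hB, hBq⟩ := hP.exists_measureReal_eq hA.compl hq
      (by rw [probReal_compl_eq_one_sub hA]; linarith)
    have hd : Disjoint A B := Set.disjoint_of_subset_right hBA disjoint_compl_right
    exact ⟨A, B, hA, hB, hd, hAp, hBq, by rw [measureReal_union hd hB, hAp, hBq]⟩
  have hsub : ∀ p q, 0 ≤ p → 0 ≤ q → p + q ≤ 1 → g (p + q) ≤ g p + g q := by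
    intro p q hp hq hpq
    obtain ⟨A, B, hA, hB, hd, rfl, rfl, hU⟩ := hpair p q hp hq hpq
    rw [← hU, ← hg _ hA, ← hg _ hB, ← hg _ (hA.union hB), indicator_union_one_eq_add hd]
    exact hR.add_le (memLp_indicator_one hA) (memLp_indicator_one hB)
  suffices h : ∃ α, 0 < α ∧ α ≤ 1 ∧ ∀ p, 0 ≤ p → p ≤ 1 → g p = min (p / α) 1 by
    obtain ⟨α, h0, h1, hα⟩ := h
    exact ⟨α, h0, h1, fun A hA => by
      rw [hg A hA, hα _ measureReal_nonneg measureReal_le_one]⟩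
  refine exists_eq_min_div_one ?_ ?_ ?_ hsub ?_ ?_ ?_
  · intro p hp q hq hpq
    obtain ⟨A, B, hA, hB, -, rfl, -, hU⟩ := hpair p (q - p) hp.1 (by linarith) (by linarith [hq.2])
    rw [add_sub_cancel] at hU
    rw [← hU, ← hg _ hA, ← hg _ (hA.union hB)]
    exact hR.indicator_mono hA (hA.union hB) Set.subset_union_left
  · have := hg ∅ MeasurableSet.empty
    rw [hR.indicator_empty, measureReal_empty] at this
    exact this.symm
  · have := hg Set.univ MeasurableSet.univ
    rw [Set.indicator_univ, hR.const, probReal_univ] at this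
    exact this.symm
  · intro p q hp hq hpq hlt
    refine (hsub p q hp hq hpq).antisymm ?_
    obtain ⟨A, B, hA, hB, hd, rfl, rfl, hU⟩ := hpair p q hp hq hpq
    rw [← hU, ← hg _ (hA.union hB)] at hlt ⊢
    rw [← hg _ hA, ← hg _ hB]
    exact hadd A B hA hB hd hlt
  · intro p L hp hp1 hL
    obtain ⟨hA, hAp⟩ := hF p hp.le hp1
    obtain ⟨B, hanti, hBA, hBm, hB0, hBl⟩ := hP.exists_antitone hA (by rwa [hAp])
    -- Left-continuity of `g`: removing ever smaller sets of positive measure exhausts `F p` up to a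
    -- null set through events of probability below `p`.
    have ht := hR.tendsto (A := fun n => F p \ B n)
      (fun m n hmn => Set.sdiff_subset_sdiff_right (hanti hmn)) fun n => hA.diff (hBm n)
    have hU : P.real (⋃ n, F p \ B n) = p := by
      apply le_antisymm
      · exact (measureReal_mono (Set.iUnion_subset fun n => Set.sdiff_subset)).trans hAp.le
      · have hl : Tendsto (fun n => p - P.real (B n)) atTop (𝓝 p) := by
          simpa using hBl.const_sub p
        refine le_of_tendsto' hl fun n => ?_
        have hd := measureReal_sdiff (μ := P) (hBA n) (hBm n)
        rw [hAp] at hd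
        rw [← hd]
        exact measureReal_mono (Set.subset_iUnion (fun n => F p \ B n) n)
    have hUg := hg (⋃ n, F p \ B n) (MeasurableSet.iUnion fun n => hA.diff (hBm n))
    rw [hU] at hUg
    rw [← hUg]
    refine le_of_tendsto' ht fun n => ?_
    rw [hg _ (hA.diff (hBm n))]
    refine hL _ measureReal_nonneg ?_
    rw [measureReal_sdiff (hBA n) (hBm n), hAp]
    linarith [hB0 n]
  · obtain ⟨A, hA, hA0, hA1⟩ := hlt
    exact ⟨P.real A, hA0, measureReal_le_one, by rwa [← hg A hA]⟩

end CohesiveRisk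

theorem mainTheorem6 {Ω : Type*} [MeasurableSpace Ω] (P : MeasureTheory.Measure Ω)
    [MeasureTheory.IsProbabilityMeasure P] (hP : CohesiveRisk.IsAtomless P)
    (N : ℕ) (hN : 2 ≤ N) (ρ : MeasureTheory.Lp ℝ ∞ P → ℝ)
    (hcoherent : CohesiveRisk.IsCoherent P ρ)
    (hcommonotonic : CohesiveRisk.IsCommonotonic P ρ)
    (hcompact : CohesiveRisk.HasWeaklyCompactScenarioSet P ρ)
    (hcohesive : CohesiveRisk.IsCohesive P N ρ)
    (hlaw : CohesiveRisk.IsLawDetermined P ρ) :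
    ∃ α : ℝ, 0 < α ∧ α ≤ 1 ∧ ∀ ξ : MeasureTheory.Lp ℝ ∞ P, CohesiveRisk.IsAVaR P α ξ (ρ ξ) := by
  have hR := CohesiveRisk.isComonotoneLoss_lossRisk hcoherent hcommonotonic hlaw
  obtain ⟨α, h0, h1, hα⟩ := CohesiveRisk.exists_indicator_eq_min_div_one hP hR
    (fun A B hA hB hd hlt => hcohesive.indicator_add_le hN hR hA hB hd hlt)
    (CohesiveRisk.exists_indicator_lt_one hP hR hcompact)
  refine ⟨α, h0, h1, fun ξ => ?_⟩
  obtain ⟨Z, M, hZ, hM, hξ⟩ := CohesiveRisk.exists_bounded_representative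
    (show MemLp (fun ω => -ξ ω) ∞ P from (Lp.memLp ξ).neg)
  obtain ⟨q, hq1, hq2⟩ := CohesiveRisk.exists_quantile (P := P) hZ hM h0 h1
  have hρ : ρ ξ = CohesiveRisk.lossRisk P ρ Z := by
    rw [← CohesiveRisk.lossRisk_neg_coeFn (ρ := ρ)]
    exact hR.congr (Lp.memLp ξ).neg hξ
  rw [hρ, hR.eq_quantile_add h0 hα hZ hM hq1 hq2]
  exact CohesiveRisk.isAVaR_quantile_add h0 hZ hM hξ hq1 hq2
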